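/- Let $A$ be a Dedekind domain which is not a field, and let $T$ be the monad on $\mathbf{Sets}$ associated to the free–forgetful adjunction between $\mathbf{Sets}$ and $\mathrm{Mod}(A)$, so that $T(S)$ is the underlying set of the free $A$-module generated by $S$. A \emph{presentation} of $T$ is a category $\mathcal{D}$ together with an adjunction $F'\colon \mathbf{Sets}\rightleftarrows \mathcal{D}\colon G'$, $F'\dashv G'$, with counit $\epsilon$, whose associated monad $G'F'$ is equal to $T$. It is \emph{homological} if for every $T$-algebra $\rho\colon G'F'X\to X$ the coequalizer in $\mathcal{D}$ of $\epsilon_{F'X},\,F'\rho\colon F'G'F'X\to F'X$ exists, and for every object $Y$ of $\mathcal{D}$ the canonical map $\mathrm{coeq}\{\epsilon_{F'G'Y},\,F'G'\epsilon_Y\}\to Y$ is an isomorphism. It is \emph{finitary} if $G'$ preserves all filtered colimits which exist in $\mathcal{D}$. A morphism of presentations $(\mathcal{D}_1,F_1,G_1)\to(\mathcal{D}_2,F_2,G_2)$ is a morphism of adjunctions over the identity of $\mathbf{Sets}$, i.e. a functor $H\colon\mathcal{D}_1\to\mathcal{D}_2$ together with natural isomorphisms $HF_1\cong F_2$ and $G_2H\cong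 G_1$ compatible with the units, the counits and the identifications $G_1F_1=T=G_2F_2$. Two morphisms are \emph{homotopic} if their underlying functors are naturally isomorphic. Let $\mathrm{Ho}(\mathrm{FinHPres}(T))$ be the (large) category whose objects are the finitary homological presentations of $T$ and whose morphisms are the homotopy classes of morphisms of presentations. Then $\mathrm{Ho}(\mathrm{FinHPres}(T))$ is equivalent, as a category, to the partially ordered set of functions \[ \mathrm{MaxSpec}(A)\to\{0,1,2,\dots,\infty\} \] from the set of maximal ideals of $A$ to the extended natural numbers, where $f\le g$ if and only if $f(\mathfrak{m})\le g(\mathfrak{m})$ for all $\mathfrak{m}\in \mathrm{MaxSpec}(A)$. In particular, $\mathrm{Ho}(\mathrm{FinHPres}(T))$ is a preorder, and its poset of isomorphism classes is isomorphic to this poset of functions. -/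

import Mathlib

open CategoryTheory CategoryTheory.Limits

universe v₁ v₂ u₁ u₂ u

/-- A presentation of a monad `T` on `C`: a category `D` with an adjunction
`F : C ⥤ D`, `G : D ⥤ C`, `F ⊣ G`, whose associated monad is equal to `T`. -/
structure MonadPresentation {C : Type u₁} [Category.{v₁} C] (T : Monad C) where
  /-- The underlying category. -/
  D : Type u₂
  [cat : Category.{v₂} D]
  /-- The left adjoint. -/
  F : C ⥤ D
  /-- The right adjoint. -/
  G : D ⥤ C
  /-- The adjunction. -/
  adj : F ⊣ G
  monad_eq : adj.toMonad = T

namespace MonadPresentation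

attribute [instance] MonadPresentation.cat

variable {C : Type u₁} [Category.{v₁} C] {T : Monad C}

/-- The identification of `F ⋙ G` with the underlying functor of `T` given by the equality
of monads. -/
def toT (P : MonadPresentation.{v₁, v₂, u₁, u₂} T) : P.F ⋙ P.G ≅ T.toFunctor :=
  eqToIso (congrArg Monad.toFunctor P.monad_eq)

/-- The two counit maps attached to `Y : D` are coequalized by the counit at `Y`. -/
theorem counit_condition (P : MonadPresentation.{v₁, v₂, u₁, u₂} T) (Y : P.D) :
    P.adj.counit.app (P.F.obj (P.G.obj Y)) ≫ P.adj.counit.app Y =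
      P.F.map (P.G.map (P.adj.counit.app Y)) ≫ P.adj.counit.app Y := by
  simp

/-- A presentation is homological if for every algebra `ρ : G (F X) ⟶ X` the coequalizer of
`ε_{F X}, F ρ : F (G (F X)) ⟶ F X` exists, and for every object `Y` of `D` the canonical map
`coeq (ε_{F (G Y)}, F (G ε_Y)) ⟶ Y` is an isomorphism. -/
def IsHomological (P : MonadPresentation.{v₁, v₂, u₁, u₂} T) : Prop :=
  (∀ X : P.adj.toMonad.Algebra,
    HasCoequalizer (P.adj.counit.app (P.F.obj X.A)) (P.F.map X.a)) ∧
  ∀ Y : P.D,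
    ∃ _ : HasCoequalizer (P.adj.counit.app (P.F.obj (P.G.obj Y)))
        (P.F.map (P.G.map (P.adj.counit.app Y))),
      IsIso (coequalizer.desc (P.adj.counit.app Y) (P.counit_condition Y))

/-- A presentation is finitary if its right adjoint preserves all (small) filtered colimits
which exist in `D`. -/
def IsFinitary (P : MonadPresentation.{v₁, v₂, u₁, u₂} T) : Prop :=
  PreservesFilteredColimits P.G

/-- A morphism of presentations of `T`: a morphism of adjunctions which is the identity on `C`,
i.e. a functor `H` with `H F_P = F_Q` and `G_Q H = G_P`, compatible with the units, the counits and
the identifications of both monads with `T`.  As usual for functors between categories, the two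
equalities of functors are taken to mean specified (coherent) natural isomorphisms. -/
structure Hom (P Q : MonadPresentation.{v₁, v₂, u₁, u₂} T) where
  /-- The functor between the underlying categories. -/
  H : P.D ⥤ Q.D
  /-- `H` commutes with the left adjoints. -/
  φ : P.F ⋙ H ≅ Q.F
  /-- `H` commutes with the right adjoints. -/
  ψ : H ⋙ Q.G ≅ P.G
  unit_comp : ∀ X : C,
    P.adj.unit.app X ≫ ψ.inv.app (P.F.obj X) ≫ Q.G.map (φ.hom.app X) = Q.adj.unit.app X
  counit_comp : ∀ Y : P.D,
    Q.F.map (ψ.hom.app Y) ≫ φ.inv.app (P.G.obj Y) ≫ H.map (P.adj.counit.app Y) =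
      Q.adj.counit.app (H.obj Y)
  toT_comp : ∀ X : C,
    ψ.inv.app (P.F.obj X) ≫ Q.G.map (φ.hom.app X) ≫ Q.toT.hom.app X = P.toT.hom.app X

namespace Hom

/-- The identity morphism. -/
@[simps]
def id (P : MonadPresentation.{v₁, v₂, u₁, u₂} T) : Hom P P where
  H := 𝟭 P.D
  φ := P.F.rightUnitor
  ψ := P.G.leftUnitor
  unit_comp := by simp
  counit_comp := by simp
  toT_comp := by simp

/-- Composition of morphisms. -/
@[simps]
def comp {P Q R : MonadPresentation.{v₁, v₂, u₁, u₂} T} (f : Hom P Q) (g : Hom Q R) :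
    Hom P R where
  H := f.H ⋙ g.H
  φ := (Functor.associator _ _ _).symm ≪≫ Functor.isoWhiskerRight f.φ g.H ≪≫ g.φ
  ψ := Functor.associator _ _ _ ≪≫ Functor.isoWhiskerLeft f.H g.ψ ≪≫ f.ψ
  unit_comp X := by
    simp [← g.unit_comp, ← f.unit_comp]
  counit_comp Y := by
    have h := f.φ.inv.naturality (f.ψ.hom.app Y)
    simp only [Functor.comp_map] at h
    simp only [← g.counit_comp, ← f.counit_comp, Functor.comp_map, Functor.comp_obj,
      Functor.map_comp, reassoc_of% h]
    simp [← Functor.map_comp, ← Functor.map_comp_assoc]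
  toT_comp X := by
    simp [← g.toT_comp, ← f.toT_comp]

/-- Two morphisms are homotopic if there is an invertible natural transformation between them. -/
def homotopic (P Q : MonadPresentation.{v₁, v₂, u₁, u₂} T) : Setoid (Hom P Q) where
  r f g := Nonempty (f.H ≅ g.H)
  iseqv := ⟨fun f => ⟨Iso.refl f.H⟩, fun ⟨e⟩ => ⟨e.symm⟩, fun ⟨e⟩ ⟨e'⟩ => ⟨e ≪≫ e'⟩⟩

/-- Composition respects homotopy. -/
theorem comp_homotopic {P Q R : MonadPresentation.{v₁, v₂, u₁, u₂} T} {f f' : Hom P Q}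
    {g g' : Hom Q R} (h : homotopic P Q f f') (h' : homotopic Q R g g') :
    homotopic P R (f.comp g) (f'.comp g') :=
  Nonempty.map2 (fun (e : f.H ≅ f'.H) (e' : g.H ≅ g'.H) => NatIso.hcomp e e') h h'

end Hom

/-- The homotopy category `Ho(Pres(T))`: presentations of `T`, and homotopy classes of morphisms. -/
instance hoPres : Category (MonadPresentation.{v₁, v₂, u₁, u₂} T) where
  Hom P Q := Quotient (Hom.homotopic P Q)
  id P := Quotient.mk _ (Hom.id P)
  comp f g := Quotient.map₂ Hom.comp
    (fun _ _ h _ _ h' => Hom.comp_homotopic h h') f g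
  id_comp := by
    rintro P Q ⟨f⟩
    exact Quotient.sound ⟨f.H.leftUnitor⟩
  comp_id := by
    rintro P Q ⟨f⟩
    exact Quotient.sound ⟨f.H.rightUnitor⟩
  assoc := by
    rintro P Q R S ⟨f⟩ ⟨g⟩ ⟨h⟩
    exact Quotient.sound ⟨Functor.associator f.H g.H h.H⟩

end MonadPresentation

/-- `Ho(FinHPres(T))`: finitary homological presentations of `T` up to natural equivalence, the
full subcategory of `Ho(Pres(T))` on the finitary homological presentations. -/
abbrev HoFinHPres {C : Type u₁} [Category.{v₁} C] (T : Monad C) :=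
  ObjectProperty.FullSubcategory
    (fun P : MonadPresentation.{v₁, v₂, u₁, u₂} T => P.IsHomological ∧ P.IsFinitary)

/-- The monad on the category of sets sending a set to the underlying set of the free `A`-module
it generates. -/
noncomputable abbrev freeModuleMonad (A : Type u) [CommRing A] : Monad (Type u) :=
  (ModuleCat.adj.{u} A).toMonad

/-- The functions from the set of maximal ideals of `A` to `{0, 1, 2, …, ∞}`. -/
def MaxSpecFunction (A : Type u) [CommRing A] : Type u :=
  MaximalSpectrum A → ℕ∞

/-- The pointwise order: `f ≤ g` if and only if `f 𝔪 ≤ g 𝔪` for all `𝔪`. -/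
instance (A : Type u) [CommRing A] : PartialOrder (MaxSpecFunction A) :=
  inferInstanceAs (PartialOrder (MaximalSpectrum A → ℕ∞))

/-!
A homological presentation of a monad `T` is, through its comparison functor, a full reflective
subcategory of the category of `T`-algebras containing the free algebras: the existence of the
coequalizers provides a left adjoint of the comparison functor, and the second condition says that
the counit of this adjunction is invertible (`IsHomological.isRightAdjoint_toAlgebra`,
`IsHomological.full_and_faithful_comparison`). A morphism of presentations commutes with the
comparison functors, so it exists if and only if there is an inclusion of essential images, and it
is unique up to homotopy (`nonempty_hom_of_essImage_le`, `Hom.homotopic_of_full_of_faithful`).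

For the free module monad, algebras are modules. The finitary condition means that the subcategory
is closed under filtered colimits, and every such class of modules arises from a presentation
(`IsFinitaryReflective`, `isFinitaryReflective_essImage_toModule`,
`IsFinitaryReflective.presentation`). It remains to classify these classes `S` over a Dedekind
domain `A`. To `S` corresponds the function `cyclicExponent S`, sending `𝔪` to the supremum of the
`k` with `A ⧸ 𝔪 ^ k ∈ S`; to a function `f` corresponds the class `torsionBounded f` of the modules
whose `𝔪`-power torsion is killed by `𝔪 ^ f 𝔪`. The quotients `A ⧸ I` with `I ≠ 0` are
self-injective rings (`Ideal.Quotient.baer_self`), which has two consequences.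

* If `M ∈ S` has an element with annihilator `I ≠ 0`, then `A ⧸ I` is a direct summand of the
  `I`-torsion of `M`, which is a kernel of maps between objects of `S`. Hence `A ⧸ I ∈ S`, and
  `S ≤ torsionBounded (cyclicExponent S)`.
* If `A ⧸ I ∈ S`, then every module killed by `I` is the kernel of a map between powers of `A ⧸ I`,
  so that it belongs to `S`. Since a module is the filtered union of its finitely generated
  submodules, and each of these is the sum of a projective module and of its primary parts,
  `torsionBounded (cyclicExponent S) ≤ S`.
-/

/-! ### Comparison functors and morphisms of presentations -/

namespace MonadPresentation

section Comparison

variable {C : Type u₁} [Category.{v₁} C] {T : Monad C}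

/-- The comparison functor of a presentation of `T`, with values in the algebras over `T` itself:
it sends `Y` to `G Y` with the action `T (G Y) ≅ G (F (G Y)) ⟶ G Y` given by the counit. -/
def toAlgebra (P : MonadPresentation.{v₁, v₂, u₁, u₂} T) : P.D ⥤ T.Algebra :=
  Monad.comparison P.adj ⋙ Monad.algebraFunctorOfMonadHom (eqToHom P.monad_eq.symm)

theorem toAlgebra_obj_a (P : MonadPresentation.{v₁, v₂, u₁, u₂} T) (Y : P.D) :
    (P.toAlgebra.obj Y).a = P.toT.inv.app (P.G.obj Y) ≫ P.G.map (P.adj.counit.app Y) := by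
  obtain @⟨D, _, F, G, adj, rfl⟩ := P
  rfl

/-- The identification `toT` is compatible with the units of both monads. -/
theorem unit_toT (P : MonadPresentation.{v₁, v₂, u₁, u₂} T) (X : C) :
    P.adj.unit.app X ≫ P.toT.hom.app X = T.η.app X := by
  obtain @⟨D, _, F, G, adj, rfl⟩ := P
  exact Category.comp_id _

/-- The identification `toT` is compatible with the multiplications of both monads. -/
theorem mul_toT (P : MonadPresentation.{v₁, v₂, u₁, u₂} T) (X : C) :
    P.G.map (P.adj.counit.app (P.F.obj X)) ≫ P.toT.hom.app X =
      P.toT.hom.app (P.G.obj (P.F.obj X)) ≫ T.map (P.toT.hom.app X) ≫ T.μ.app X := by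
  obtain @⟨D, _, F, G, adj, rfl⟩ := P
  change G.map _ ≫ 𝟙 (G.obj (F.obj X)) = 𝟙 (G.obj (F.obj (G.obj (F.obj X)))) ≫
    G.map (F.map (𝟙 (G.obj (F.obj X)))) ≫ G.map (adj.counit.app (F.obj X))
  simp

/-- The comparison functor sends `F X` to the free `T`-algebra on `X`. -/
def freeCompToAlgebra (P : MonadPresentation.{v₁, v₂, u₁, u₂} T) :
    P.F ⋙ P.toAlgebra ≅ T.free :=
  NatIso.ofComponents
    (fun X => Monad.Algebra.isoMk (P.toT.app X) (by
      refine Eq.trans ?_ (congrArg (fun k => k ≫ P.toT.hom.app X)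
        (P.toAlgebra_obj_a (P.F.obj X))).symm
      have h : T.map (P.toT.hom.app X) ≫ T.μ.app X =
          P.toT.inv.app (P.G.obj (P.F.obj X)) ≫ P.G.map (P.adj.counit.app (P.F.obj X)) ≫
            P.toT.hom.app X := by
        rw [mul_toT]
        exact (Iso.inv_hom_id_app_assoc _ _ _).symm
      exact h.trans (Category.assoc _ _ _).symm))
    (fun f => by
      ext
      exact P.toT.hom.naturality f)

theorem Hom.toT_inv {P Q : MonadPresentation.{v₁, v₂, u₁, u₂} T} (f : Hom P Q) (X : C) :
    Q.toT.inv.app X ≫ Q.G.map (f.φ.inv.app X) ≫ f.ψ.hom.app (P.F.obj X) = P.toT.inv.app X := by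
  have h : Q.G.map (f.φ.inv.app X) ≫ Q.G.map (f.φ.hom.app X) = 𝟙 (Q.G.obj (Q.F.obj X)) := by
    rw [← Functor.map_comp, Iso.inv_hom_id_app, CategoryTheory.Functor.map_id]
  have h' : f.ψ.hom.app (P.F.obj X) ≫ f.ψ.inv.app (P.F.obj X) =
      𝟙 (Q.G.obj (f.H.obj (P.F.obj X))) := Iso.hom_inv_id_app _ _
  have h'' : Q.toT.inv.app X ≫ Q.toT.hom.app X = 𝟙 (T.obj X) := Iso.inv_hom_id_app _ _
  rw [← cancel_mono (P.toT.hom.app X), Iso.inv_hom_id_app, ← f.toT_comp]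
  simp only [Category.assoc]
  rw [reassoc_of% h', reassoc_of% h]
  exact h''

/-- The isomorphism `G_Q (H Y) ≅ G_P Y` of a morphism of presentations is compatible with the
actions of `T`. -/
theorem Hom.map_ψ_action {P Q : MonadPresentation.{v₁, v₂, u₁, u₂} T} (f : Hom P Q) (Y : P.D) :
    T.map (f.ψ.hom.app Y) ≫ P.toT.inv.app (P.G.obj Y) ≫ P.G.map (P.adj.counit.app Y) =
      Q.toT.inv.app (Q.G.obj (f.H.obj Y)) ≫ Q.G.map (Q.adj.counit.app (f.H.obj Y)) ≫
        f.ψ.hom.app Y := by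
  have h₁ : Q.G.map (f.H.map (P.adj.counit.app Y)) ≫ f.ψ.hom.app Y =
    f.ψ.hom.app (P.F.obj (P.G.obj Y)) ≫ P.G.map (P.adj.counit.app Y) :=
      f.ψ.hom.naturality (P.adj.counit.app Y)
  have h₂ : T.map (f.ψ.hom.app Y) ≫ Q.toT.inv.app (P.G.obj Y) =
    Q.toT.inv.app (Q.G.obj (f.H.obj Y)) ≫ Q.G.map (Q.F.map (f.ψ.hom.app Y)) :=
      Q.toT.inv.naturality (f.ψ.hom.app Y)
  rw [← f.toT_inv, ← f.counit_comp]
  simp only [Functor.map_comp, Category.assoc]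
  rw [h₁, reassoc_of% h₂]

/-- A morphism of presentations commutes with the comparison functors. -/
def Hom.compToAlgebra {P Q : MonadPresentation.{v₁, v₂, u₁, u₂} T} (f : Hom P Q) :
    f.H ⋙ Q.toAlgebra ≅ P.toAlgebra :=
  NatIso.ofComponents
    (fun Y => Monad.Algebra.isoMk (f.ψ.app Y) (by
      refine (congrArg (fun k => T.map (f.ψ.hom.app Y) ≫ k) (P.toAlgebra_obj_a Y)).trans
        (Eq.trans ?_ (congrArg (fun k => k ≫ f.ψ.hom.app Y)
          (Q.toAlgebra_obj_a (f.H.obj Y))).symm)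
      exact (f.map_ψ_action Y).trans (Category.assoc _ _ _).symm))
    (fun g => by
      ext
      exact f.ψ.hom.naturality g)

/-- If the comparison functor of `Q` is fully faithful, there is at most one morphism to `Q` up to
homotopy. -/
theorem Hom.homotopic_of_full_of_faithful {P Q : MonadPresentation.{v₁, v₂, u₁, u₂} T}
    [Q.toAlgebra.Full] [Q.toAlgebra.Faithful] (f g : Hom P Q) : Nonempty (f.H ≅ g.H) :=
  ⟨Functor.fullyFaithfulCancelRight Q.toAlgebra (f.compToAlgebra ≪≫ g.compToAlgebra.symm)⟩

theorem Hom.essImage_le {P Q : MonadPresentation.{v₁, v₂, u₁, u₂} T} (f : Hom P Q) :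
    P.toAlgebra.essImage ≤ Q.toAlgebra.essImage := by
  rintro X ⟨Y, ⟨e⟩⟩
  exact ⟨f.H.obj Y, ⟨f.compToAlgebra.app Y ≪≫ e⟩⟩

variable {P Q : MonadPresentation.{v₁, v₂, u₁, u₂} T} (H : P.D ⥤ Q.D)
  (e : H ⋙ Q.toAlgebra ≅ P.toAlgebra)

/-- The isomorphism `H ⋙ G_Q ≅ G_P` attached to a functor `H` commuting with the comparison
functors. -/
def compForgetIso : H ⋙ Q.G ≅ P.G :=
  Functor.isoWhiskerRight e T.forget

/-- The isomorphism `compForgetIso` is compatible with the actions of `T`, since it underlies an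
isomorphism of algebras. -/
theorem map_compForgetIso (Y : P.D) :
    T.map ((compForgetIso H e).hom.app Y) ≫ P.toT.inv.app (P.G.obj Y) ≫
      P.G.map (P.adj.counit.app Y) =
    Q.toT.inv.app (Q.G.obj (H.obj Y)) ≫ Q.G.map (Q.adj.counit.app (H.obj Y)) ≫
      (compForgetIso H e).hom.app Y := by
  have h := (congrArg (fun k => T.map (e.hom.app Y).f ≫ k) (P.toAlgebra_obj_a Y)).symm.trans
    ((e.hom.app Y).h.trans
      (congrArg (fun k => k ≫ (e.hom.app Y).f) (Q.toAlgebra_obj_a (H.obj Y))))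
  exact h.trans (Category.assoc _ _ _)

variable [Q.toAlgebra.Full] [Q.toAlgebra.Faithful]

/-- The isomorphism `F_P ⋙ H ≅ F_Q` attached to a functor `H` commuting with the comparison
functors. -/
noncomputable def freeCompIso : P.F ⋙ H ≅ Q.F :=
  Functor.fullyFaithfulCancelRight Q.toAlgebra
    (Functor.associator _ _ _ ≪≫ Functor.isoWhiskerLeft P.F e ≪≫ P.freeCompToAlgebra ≪≫
      Q.freeCompToAlgebra.symm)

/-- Under the right adjoints, `freeCompIso` becomes the isomorphism determined by `compForgetIso` and
the identifications of both monads with `T`. -/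
theorem map_freeCompIso_hom (X : C) :
    Q.G.map ((freeCompIso H e).hom.app X) =
      (compForgetIso H e).hom.app (P.F.obj X) ≫ P.toT.hom.app X ≫ Q.toT.inv.app X := by
  have h : Q.toAlgebra.map ((freeCompIso H e).hom.app X) =
      e.hom.app (P.F.obj X) ≫ P.freeCompToAlgebra.hom.app X ≫ Q.freeCompToAlgebra.inv.app X := by
    simp [freeCompIso]
  exact congrArg Monad.Algebra.Hom.f h

theorem map_freeCompIso_inv (X : C) :
    Q.G.map ((freeCompIso H e).inv.app X) =
      Q.toT.hom.app X ≫ P.toT.inv.app X ≫ (compForgetIso H e).inv.app (P.F.obj X) := by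
  rw [← cancel_epi (Q.G.map ((freeCompIso H e).hom.app X)), ← Functor.map_comp,
    map_freeCompIso_hom]
  simp

/-- A functor which commutes with the comparison functors underlies a morphism of presentations,
if the comparison functor of the target is fully faithful. -/
noncomputable def Hom.ofCompToAlgebra : Hom P Q where
  H := H
  φ := freeCompIso H e
  ψ := compForgetIso H e
  unit_comp X := by
    rw [map_freeCompIso_hom, Iso.inv_hom_id_app_assoc, ← Category.assoc, unit_toT, ← unit_toT Q]
    simp
  counit_comp Y := by
    have : Q.G.Faithful := by
      change (Q.toAlgebra ⋙ T.forget).Faithful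
      infer_instance
    apply Q.G.map_injective
    have h₁ : P.G.map (P.adj.counit.app Y) ≫ (compForgetIso H e).inv.app Y =
      (compForgetIso H e).inv.app (P.F.obj (P.G.obj Y)) ≫ Q.G.map (H.map (P.adj.counit.app Y)) :=
        (compForgetIso H e).inv.naturality (P.adj.counit.app Y)
    have h₂ : Q.G.map (Q.F.map ((compForgetIso H e).hom.app Y)) ≫ Q.toT.hom.app (P.G.obj Y) =
      Q.toT.hom.app (Q.G.obj (H.obj Y)) ≫ T.map ((compForgetIso H e).hom.app Y) :=
        Q.toT.hom.naturality ((compForgetIso H e).hom.app Y)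
    simp only [Functor.map_comp, map_freeCompIso_inv, Category.assoc]
    rw [← h₁, reassoc_of% h₂, reassoc_of% (map_compForgetIso H e Y)]
    simp
  toT_comp X := by
    rw [map_freeCompIso_hom]
    simp

theorem nonempty_hom_of_essImage_le (h : P.toAlgebra.essImage ≤ Q.toAlgebra.essImage) :
    Nonempty (Hom P Q) :=
  ⟨Hom.ofCompToAlgebra _ (Functor.essImage.liftFunctorCompIso P.toAlgebra Q.toAlgebra
    fun Y => h _ (P.toAlgebra.obj_mem_essImage Y))⟩

end Comparison

/-! ### Homological presentations -/

section Homological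

variable {C : Type u₁} [Category.{v₁} C] {T : Monad C}

theorem hasCoequalizer_swap {D : Type u₂} [Category.{v₂} D] {X Y : D} (f g : X ⟶ Y)
    [HasCoequalizer f g] : HasCoequalizer g f :=
  HasColimit.mk ⟨_, Cofork.IsColimit.mk (Cofork.ofπ (coequalizer.π f g)
    (coequalizer.condition f g).symm) (fun s => coequalizer.desc s.π s.condition.symm)
    (fun _ => coequalizer.π_desc _ _)
    (fun _ _ hm => coequalizer.hom_ext (hm.trans (coequalizer.π_desc _ _).symm))⟩

open Monad.MonadicityInternal in
/-- The canonical map from the coequalizer to `Y` is, up to exchanging the two maps of the pair, the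
counit of the adjunction between the comparison functor and its left adjoint. -/
theorem isIso_desc_counit_iff (P : MonadPresentation.{v₁, v₁, u₁, u₂} T)
    [∀ X : P.adj.toMonad.Algebra,
      HasCoequalizer (P.F.map X.a) (P.adj.counit.app (P.F.obj X.A))] (Y : P.D)
    [HasCoequalizer (P.adj.counit.app (P.F.obj (P.G.obj Y)))
        (P.F.map (P.G.map (P.adj.counit.app Y)))] :
    IsIso (coequalizer.desc (P.adj.counit.app Y) (P.counit_condition Y)) ↔
      IsIso ((comparisonAdjunction P.adj).counit.app Y) := by
  rw [comparisonAdjunction_counit_app]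
  have hc : HasCoequalizer (P.F.map (P.G.map (P.adj.counit.app Y)))
    (P.adj.counit.app (P.F.obj (P.G.obj Y))) := inferInstance
  let α : coequalizer (P.F.map (P.G.map (P.adj.counit.app Y)))
      (P.adj.counit.app (P.F.obj (P.G.obj Y))) ≅
      coequalizer (P.adj.counit.app (P.F.obj (P.G.obj Y)))
        (P.F.map (P.G.map (P.adj.counit.app Y))) :=
    { hom := coequalizer.desc (coequalizer.π _ _) (coequalizer.condition _ _).symm
      inv := coequalizer.desc (coequalizer.π _ _) (coequalizer.condition _ _).symm }
  have h : colimit.desc _ (counitCofork P.adj Y) =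
      α.hom ≫ coequalizer.desc (P.adj.counit.app Y) (P.counit_condition Y) := by
    apply coequalizer.hom_ext
    exact (coequalizer.π_desc _ _).trans
      ((coequalizer.π_desc_assoc _ _ _).trans (coequalizer.π_desc _ _)).symm
  rw [h]
  have : IsIso α.hom := α.isIso_hom
  exact (isIso_comp_left_iff α.hom _).symm

instance (P : MonadPresentation.{v₁, v₂, u₁, u₂} T) :
    (Monad.algebraFunctorOfMonadHom (eqToHom P.monad_eq.symm)).IsEquivalence :=
  (Monad.algebraEquivOfIsoMonads (eqToIso P.monad_eq)).isEquivalence_functor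

namespace IsHomological

variable {P : MonadPresentation.{v₁, v₁, u₁, u₂} T}

theorem hasCoequalizer (hP : P.IsHomological) (X : P.adj.toMonad.Algebra) :
    HasCoequalizer (P.F.map X.a) (P.adj.counit.app (P.F.obj X.A)) :=
  @hasCoequalizer_swap _ _ _ _ _ _ (hP.1 X)

open Monad.MonadicityInternal in
theorem isRightAdjoint_toAlgebra (hP : P.IsHomological) : P.toAlgebra.IsRightAdjoint := by
  have := hP.hasCoequalizer
  have : (Monad.comparison P.adj).IsRightAdjoint := (comparisonAdjunction P.adj).isRightAdjoint
  unfold toAlgebra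
  infer_instance

open Monad.MonadicityInternal in
/-- The second half of the definition of a homological presentation says that the counit of the
adjunction between the comparison functor and its left adjoint is invertible. -/
theorem full_and_faithful_comparison (hP : P.IsHomological) :
    (Monad.comparison P.adj).Full ∧ (Monad.comparison P.adj).Faithful := by
  have := hP.hasCoequalizer
  have (Y : P.D) : IsIso ((comparisonAdjunction P.adj).counit.app Y) := by
    obtain ⟨_, h⟩ := hP.2 Y
    exact (P.isIso_desc_counit_iff Y).1 h
  have : IsIso (comparisonAdjunction P.adj).counit := NatIso.isIso_of_isIso_app _
  have h := (comparisonAdjunction P.adj).fullyFaithfulROfIsIsoCounit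
  exact ⟨h.full, h.faithful⟩

theorem full_toAlgebra (hP : P.IsHomological) : P.toAlgebra.Full := by
  have := hP.full_and_faithful_comparison.1
  unfold toAlgebra
  infer_instance

theorem faithful_toAlgebra (hP : P.IsHomological) : P.toAlgebra.Faithful := by
  have := hP.full_and_faithful_comparison.2
  unfold toAlgebra
  infer_instance

open Monad.MonadicityInternal in
theorem of_hasCoequalizers [HasCoequalizers P.D] [P.toAlgebra.Full] [P.toAlgebra.Faithful] :
    P.IsHomological := by
  refine ⟨fun X => inferInstance, fun Y => ⟨inferInstance, ?_⟩⟩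
  rw [P.isIso_desc_counit_iff Y]
  have h : (Monad.comparison P.adj ⋙
    Monad.algebraFunctorOfMonadHom (eqToHom P.monad_eq.symm)).FullyFaithful :=
      Functor.FullyFaithful.ofFullyFaithful P.toAlgebra
  have := h.full
  have := h.faithful
  have : (Monad.comparison P.adj).Faithful := Functor.Faithful.of_comp _
    (Monad.algebraFunctorOfMonadHom (eqToHom P.monad_eq.symm))
  have : (Monad.comparison P.adj).Full := Functor.Full.of_comp_faithful _
    (Monad.algebraFunctorOfMonadHom (eqToHom P.monad_eq.symm))
  infer_instance

end IsHomological

end Homological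

end MonadPresentation

/-! ### Modules are the algebras over the free module monad -/

section Monadicity

variable {A : Type u} [CommRing A]

/-- In a reflexive pair `f, g` of linear maps, two elements of the target are related by a single
element of the source as soon as they agree in the coequalizer. -/
theorem LinearMap.exists_eq_and_eq_of_sub_mem_range {M N : Type*} [AddCommGroup M] [AddCommGroup N]
    [Module A M] [Module A N] {f g : M →ₗ[A] N} {r : N →ₗ[A] M} (hf : ∀ x, f (r x) = x)
    (hg : ∀ x, g (r x) = x) {x y : N} (h : x - y ∈ LinearMap.range (f - g)) :
    ∃ z, f z = x ∧ g z = y := by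
  obtain ⟨m, hm⟩ := h
  -- The common section `r` moves `m` so that its image under `g` becomes `y`.
  refine ⟨m + r (y - g m), ?_, ?_⟩
  · rw [map_add, hf, ← add_sub_assoc, add_sub_right_comm, ← LinearMap.sub_apply, hm]
    abel
  · rw [map_add, hg]
    abel

theorem ModuleCat.preservesColimit_parallelPair_forget {M N : ModuleCat.{u} A} (f g : M ⟶ N)
    [IsReflexivePair f g] :
    PreservesColimit (parallelPair f g) (forget (ModuleCat.{u} A)) := by
  have w : f ≫ ModuleCat.ofHom (LinearMap.range (f.hom - g.hom)).mkQ =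
      g ≫ ModuleCat.ofHom (LinearMap.range (f.hom - g.hom)).mkQ := by
    ext x
    exact (Submodule.Quotient.eq _).2 ⟨x, rfl⟩
  have hc : IsColimit (Cofork.ofπ _ w) := Cofork.IsColimit.mk _
    (fun s => ModuleCat.ofHom ((LinearMap.range (f.hom - g.hom)).liftQ s.π.hom (by
      rintro _ ⟨x, rfl⟩
      have := congrArg (fun k => k.hom x) s.condition
      simpa [sub_eq_zero] using this)))
    (fun s => by ext x; rfl)
    (fun s m hm => ModuleCat.hom_ext
      (Submodule.linearMap_qext _ (congrArg ModuleCat.Hom.hom hm)))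
  refine preservesColimit_of_preserves_colimit_cocone hc
    ((isColimitMapCoconeCoforkEquiv (forget (ModuleCat.{u} A)) w).symm ?_)
  have hs (x : N) : f.hom ((commonSection f g).hom x) = x ∧
      g.hom ((commonSection f g).hom x) = x :=
    ⟨congrArg (fun k => k.hom x) (section_comp_left f g),
      congrArg (fun k => k.hom x) (section_comp_right f g)⟩
  have hsurj : Function.Surjective (LinearMap.range (f.hom - g.hom)).mkQ :=
    Submodule.mkQ_surjective _
  have key (s : Cofork ((forget (ModuleCat.{u} A)).map f) ((forget (ModuleCat.{u} A)).map g))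
      (x y : N) (h : (LinearMap.range (f.hom - g.hom)).mkQ x =
        (LinearMap.range (f.hom - g.hom)).mkQ y) : s.π x = s.π y := by
    obtain ⟨z, rfl, rfl⟩ := LinearMap.exists_eq_and_eq_of_sub_mem_range
      (fun x => (hs x).1) (fun x => (hs x).2) ((Submodule.Quotient.eq _).1 h)
    exact congrArg (fun k => k z) s.condition
  exact Cofork.IsColimit.mk _
    (fun s => ↾fun q => s.π (Function.surjInv hsurj q))
    (fun s => by
      ext x
      exact key s _ _ (Function.surjInv_eq hsurj _))
    (fun s m hm => by
      ext q
      obtain ⟨x, rfl⟩ := hsurj q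
      exact (congrArg (fun k => k x) hm).trans (key s _ _ (Function.surjInv_eq hsurj _).symm))

variable (A) in
/-- The forgetful functor from modules to sets is monadic, by the reflexive monadicity theorem. -/
theorem ModuleCat.isEquivalence_comparison_adj :
    (Monad.comparison (ModuleCat.adj.{u} A)).IsEquivalence := by
  have : Monad.PreservesColimitOfIsReflexivePair (forget (ModuleCat.{u} A)) :=
    ⟨fun _ _ f g _ => ModuleCat.preservesColimit_parallelPair_forget f g⟩
  exact (Monad.monadicOfHasPreservesReflexiveCoequalizersOfReflectsIsomorphisms
    (ModuleCat.adj.{u} A)).eqv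

end Monadicity

/-! ### Presentations of the free module monad as classes of modules -/

/-- A class of modules which is the class of objects of a replete reflective subcategory, contains
the free modules, and is closed under filtered colimits. -/
structure IsFinitaryReflective {A : Type u} [CommRing A] (S : ObjectProperty (ModuleCat.{u} A)) :
    Prop where
  isClosedUnderIsomorphisms : S.IsClosedUnderIsomorphisms
  isRightAdjoint_ι : S.ι.IsRightAdjoint
  isClosedUnderColimitsOfShape (J : Type u) [SmallCategory J] [IsFiltered J] :
    S.IsClosedUnderColimitsOfShape J
  free (X : Type u) : S ((ModuleCat.free A).obj X)

namespace MonadPresentation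

variable {A : Type u} [CommRing A]

/-- The equivalence between algebras over the free module monad and modules. -/
noncomputable def algebraToModule : (freeModuleMonad A).Algebra ⥤ ModuleCat.{u} A :=
  have := ModuleCat.isEquivalence_comparison_adj A
  (Monad.comparison (ModuleCat.adj.{u} A)).inv

instance : (algebraToModule (A := A)).IsEquivalence := by
  unfold algebraToModule
  infer_instance

/-- The inverse of the comparison functor commutes with the comparison functor. -/
noncomputable def comparisonCompAlgebraToModule :
    Monad.comparison (ModuleCat.adj.{u} A) ⋙ algebraToModule ≅ 𝟭 _ :=
  have := ModuleCat.isEquivalence_comparison_adj A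
  (Monad.comparison (ModuleCat.adj.{u} A)).asEquivalence.unitIso.symm

/-- The module attached to an algebra has the same underlying set. -/
noncomputable def algebraToModuleCompForget :
    algebraToModule ⋙ forget (ModuleCat.{u} A) ≅ (freeModuleMonad A).forget :=
  have := ModuleCat.isEquivalence_comparison_adj A
  Functor.isoWhiskerRight (Monad.comparison (ModuleCat.adj.{u} A)).asEquivalence.counitIso
    (freeModuleMonad A).forget

/-- The module structure on `G Y`, for an object `Y` of a presentation of the free module monad. -/
noncomputable def toModule (P : MonadPresentation.{u, u, u + 1, u + 1} (freeModuleMonad A)) :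
    P.D ⥤ ModuleCat.{u} A :=
  P.toAlgebra ⋙ algebraToModule

variable (P Q : MonadPresentation.{u, u, u + 1, u + 1} (freeModuleMonad A))

theorem essImage_toModule_obj (X : (freeModuleMonad A).Algebra) :
    P.toModule.essImage (algebraToModule.obj X) ↔ P.toAlgebra.essImage X :=
  ⟨fun ⟨Y, ⟨e⟩⟩ => ⟨Y, ⟨algebraToModule.preimageIso e⟩⟩,
    fun ⟨Y, ⟨e⟩⟩ => ⟨Y, ⟨algebraToModule.mapIso e⟩⟩⟩

theorem essImage_toModule_le_iff :
    P.toModule.essImage ≤ Q.toModule.essImage ↔ P.toAlgebra.essImage ≤ Q.toAlgebra.essImage := by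
  refine ⟨fun h X hX => ?_, ?_⟩
  · rw [← essImage_toModule_obj] at hX ⊢
    exact h _ hX
  · rintro h M ⟨Y, ⟨e⟩⟩
    exact Functor.essImage.ofIso e
      ((Q.essImage_toModule_obj _).2 (h _ (P.toAlgebra.obj_mem_essImage Y)))

variable {P}

theorem isFinitaryReflective_essImage_toModule (hP : P.IsHomological) (hP' : P.IsFinitary) :
    IsFinitaryReflective P.toModule.essImage := by
  have := hP.full_toAlgebra
  have := hP.faithful_toAlgebra
  have := hP.isRightAdjoint_toAlgebra
  have : P.toModule.Full := by unfold toModule; infer_instance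
  have : P.toModule.Faithful := by unfold toModule; infer_instance
  have : P.toModule.IsRightAdjoint := by unfold toModule; infer_instance
  let _ : Reflective P.toModule := ⟨_, Adjunction.ofIsRightAdjoint _⟩
  refine ⟨inferInstance, ?_, fun J _ _ => ?_, fun X => ⟨P.F.obj X, ⟨?_⟩⟩⟩
  · have : P.toModule.toEssImage.IsEquivalence := { }
    have e : P.toModule.toEssImage.inv ⋙ P.toModule ≅ P.toModule.essImage.ι :=
      Functor.isoWhiskerLeft P.toModule.toEssImage.inv P.toModule.toEssImageCompι.symm ≪≫
      (Functor.associator _ _ _).symm ≪≫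
      Functor.isoWhiskerRight P.toModule.toEssImage.asEquivalence.counitIso P.toModule.essImage.ι
    exact Functor.isRightAdjoint_of_iso e
  · have := hP'.preserves_filtered_colimits J
    have : HasColimitsOfShape J P.D := hasColimitsOfShape_of_reflective P.toModule
    have e : P.toModule ⋙ forget (ModuleCat.{u} A) ≅ P.G :=
      Functor.isoWhiskerLeft P.toAlgebra algebraToModuleCompForget
    have := preservesColimitsOfShape_of_natIso (J := J) e.symm
    have : PreservesColimitsOfShape J P.toModule :=
      preservesColimitsOfShape_of_reflects_of_preserves P.toModule (forget (ModuleCat.{u} A))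
    infer_instance
  · exact (Functor.isoWhiskerRight P.freeCompToAlgebra algebraToModule ≪≫
      Functor.isoWhiskerLeft (ModuleCat.free A) comparisonCompAlgebraToModule).app X

end MonadPresentation

namespace IsFinitaryReflective

variable {A : Type u} [CommRing A] {S : ObjectProperty (ModuleCat.{u} A)}

/-- The free-forgetful adjunction between sets and a full subcategory of modules containing the
free modules. -/
noncomputable def adj (hS : IsFinitaryReflective S) :
    S.lift (ModuleCat.free A) hS.free ⊣ S.ι ⋙ forget (ModuleCat.{u} A) where
  unit := (ModuleCat.adj A).unit
  counit :=
    { app Y := ObjectProperty.homMk ((ModuleCat.adj A).counit.app Y.obj)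
      naturality Y Z f := by
        ext : 1
        exact (ModuleCat.adj A).counit.naturality f.hom }
  left_triangle_components X := by
    ext : 1
    exact (ModuleCat.adj A).left_triangle_components X
  right_triangle_components Y := (ModuleCat.adj A).right_triangle_components Y.obj

/-- The presentation of the free module monad by a full subcategory of modules. -/
noncomputable def presentation (hS : IsFinitaryReflective S) :
    MonadPresentation.{u, u, u + 1, u + 1} (freeModuleMonad A) where
  D := S.FullSubcategory
  F := S.lift (ModuleCat.free A) hS.free
  G := S.ι ⋙ forget (ModuleCat.{u} A)
  adj := hS.adj
  monad_eq := rfl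

/-- The algebra attached to a module in the subcategory is its underlying set with the action of
the free module monad coming from its module structure. -/
noncomputable def toAlgebraIso (hS : IsFinitaryReflective S) :
    hS.presentation.toAlgebra ≅ S.ι ⋙ Monad.comparison (ModuleCat.adj.{u} A) :=
  Iso.refl _

theorem isHomological_presentation (hS : IsFinitaryReflective S) :
    hS.presentation.IsHomological := by
  have := hS.isRightAdjoint_ι
  let _ : Reflective S.ι := ⟨_, Adjunction.ofIsRightAdjoint _⟩
  have : HasCoequalizers S.FullSubcategory := hasColimitsOfShape_of_reflective S.ι
  have : HasCoequalizers hS.presentation.D := this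
  have := ModuleCat.isEquivalence_comparison_adj A
  have : hS.presentation.toAlgebra.Full := 
    Functor.Full.comp S.ι (Monad.comparison (ModuleCat.adj.{u} A))
  have : hS.presentation.toAlgebra.Faithful := 
    Functor.Faithful.comp S.ι (Monad.comparison (ModuleCat.adj.{u} A))
  exact MonadPresentation.IsHomological.of_hasCoequalizers

theorem isFinitary_presentation (hS : IsFinitaryReflective S) :
    hS.presentation.IsFinitary := by
  refine ⟨fun J _ _ => ?_⟩
  have := hS.isClosedUnderColimitsOfShape J
  change PreservesColimitsOfShape J (S.ι ⋙ forget (ModuleCat.{u} A))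
  infer_instance

theorem essImage_toModule_presentation (hS : IsFinitaryReflective S) :
    hS.presentation.toModule.essImage = S := by
  have := hS.isClosedUnderIsomorphisms
  let e : hS.presentation.toModule ≅ S.ι :=
    Functor.isoWhiskerRight hS.toAlgebraIso MonadPresentation.algebraToModule ≪≫
      Functor.isoWhiskerLeft S.ι MonadPresentation.comparisonCompAlgebraToModule
  ext M
  refine ⟨fun ⟨Y, ⟨i⟩⟩ => S.prop_of_iso ((e.app Y).symm ≪≫ i) Y.property,
    fun h => ⟨(⟨M, h⟩ : S.FullSubcategory), ⟨e.app _⟩⟩⟩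

end IsFinitaryReflective

/-! ### Self-injectivity of the quotients of a Dedekind domain -/

section Quotient

variable {A : Type u} [CommRing A] [IsDedekindDomain A]

/-- A proper quotient of a Dedekind domain is a self-injective ring. The point is that an ideal
`J ⊇ I` is generated by one element modulo `I`, and divides `I`, so that an element killed by the
complementary factor of `J` lies in `J`. -/
theorem Ideal.Quotient.baer_self {I : Ideal A} (hI : I ≠ ⊥) : Module.Baer (A ⧸ I) (A ⧸ I) := by
  intro L g
  set J : Ideal A := L.comap (Ideal.Quotient.mk I) with hJ
  have hIJ : I ≤ J := fun x hx => by
    rw [hJ, Ideal.mem_comap, Ideal.Quotient.eq_zero_iff_mem.2 hx]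
    exact L.zero_mem
  obtain ⟨a, ha⟩ := IsDedekindDomain.exists_sup_span_eq hIJ hI
  obtain ⟨J', hJ'⟩ := Ideal.dvd_iff_le.2 hIJ
  have hJ'0 : J' ≠ 0 := by
    rintro rfl
    exact hI (by simpa using hJ')
  have haJ : a ∈ J := ha ▸ Ideal.mem_sup_right (Ideal.mem_span_singleton_self a)
  obtain ⟨b, hb⟩ := Ideal.Quotient.mk_surjective (g ⟨Ideal.Quotient.mk I a, haJ⟩)
  -- As `J' * (a) ≤ I`, the image `b` of `a` satisfies `J' * (b) ≤ I = J * J'`.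
  have hbJ : b ∈ J := by
    rw [← Ideal.span_singleton_le_iff_mem, ← Ideal.dvd_iff_le, ← mul_dvd_mul_iff_right hJ'0, ← hJ',
      Ideal.dvd_iff_le, Ideal.mul_le]
    intro b' hb' c hc
    obtain ⟨d, rfl⟩ := Ideal.mem_span_singleton.1 hb'
    rw [mul_right_comm, mul_comm b c]
    refine I.mul_mem_right _ ?_
    have hca : Ideal.Quotient.mk I (c * a) = 0 := by
      rw [Ideal.Quotient.eq_zero_iff_mem, hJ', mul_comm]
      exact Ideal.mul_mem_mul hc haJ
    rw [← Ideal.Quotient.eq_zero_iff_mem, map_mul, hb, ← smul_eq_mul, ← map_smul]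
    convert! map_zero g
    exact Subtype.ext ((map_mul _ _ _).symm.trans hca)
  have hmem {y : A} (hy : y ∈ J) :
      ∃ r : A, Ideal.Quotient.mk I y = Ideal.Quotient.mk I r * Ideal.Quotient.mk I a := by
    rw [← ha, Submodule.mem_sup] at hy
    obtain ⟨z, hz, w, hw, rfl⟩ := hy
    obtain ⟨r, rfl⟩ := Ideal.mem_span_singleton'.1 hw
    exact ⟨r, by rw [map_add, Ideal.Quotient.eq_zero_iff_mem.2 hz, zero_add, map_mul]⟩
  obtain ⟨r, hr⟩ := hmem hbJ
  refine ⟨LinearMap.mulLeft _ (Ideal.Quotient.mk I r), fun y hy => ?_⟩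
  obtain ⟨y, rfl⟩ := Ideal.Quotient.mk_surjective y
  obtain ⟨s, hs⟩ := hmem (show y ∈ J from hy)
  have : (⟨Ideal.Quotient.mk I y, hy⟩ : L) =
      Ideal.Quotient.mk I s • ⟨Ideal.Quotient.mk I a, haJ⟩ := Subtype.ext hs
  rw [this, map_smul, ← hb, hr, hs, LinearMap.mulLeft_apply, smul_eq_mul]
  ring

variable {N : Type u} [AddCommGroup N] [Module A N]

/-- Self-injectivity of `A ⧸ I`, in terms of elements of a module killed by `I`. -/
theorem Module.IsTorsionBySet.exists_linearMap_apply_eq {I : Ideal A} (hI : I ≠ ⊥)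
    (hN : Module.IsTorsionBySet A N I) (x : N) (b : A ⧸ I) (hb : ∀ a : A, a • x = 0 → a • b = 0) :
    ∃ φ : N →ₗ[A] A ⧸ I, φ x = b := by
  let _ : Module (A ⧸ I) N := hN.module
  have hsmul (a : A) (y : N) : Ideal.Quotient.mk I a • y = a • y := rfl
  -- The map `x ↦ b` is well defined on the submodule generated by `x`, and extends to `N`.
  let p : A ⧸ I →ₗ[A ⧸ I] N := LinearMap.toSpanSingleton _ _ x
  have hp : LinearMap.ker p.rangeRestrict ≤
      LinearMap.ker (LinearMap.toSpanSingleton (A ⧸ I) _ b) := by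
    intro a ha
    obtain ⟨a, rfl⟩ := Ideal.Quotient.mk_surjective a
    rw [LinearMap.ker_rangeRestrict] at ha
    exact hb a ha
  let q : LinearMap.range p →ₗ[A ⧸ I] A ⧸ I :=
    (Submodule.liftQ _ (LinearMap.toSpanSingleton (A ⧸ I) _ b) hp) ∘ₗ
      (p.rangeRestrict.quotKerEquivOfSurjective p.surjective_rangeRestrict).symm.toLinearMap
  obtain ⟨φ, hφ⟩ := (Ideal.Quotient.baer_self hI).extension_property
    (LinearMap.range p).subtype Subtype.val_injective q
  have hx : (LinearMap.range p).subtype (p.rangeRestrict 1) = x := one_smul _ _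
  refine ⟨{ toFun := φ, map_add' := φ.map_add, map_smul' := fun a y => ?_ }, ?_⟩
  · exact φ.map_smul (Ideal.Quotient.mk I a) y
  · change φ x = b
    rw [← hx, ← LinearMap.comp_apply, hφ]
    change Submodule.liftQ _ _ hp ((p.rangeRestrict.quotKerEquivOfSurjective
      p.surjective_rangeRestrict).symm (p.rangeRestrict 1)) = b
    have : (p.rangeRestrict.quotKerEquivOfSurjective
      p.surjective_rangeRestrict).symm (p.rangeRestrict 1) = Submodule.Quotient.mk 1 := by
      rw [LinearEquiv.symm_apply_eq]
      rfl
    rw [this]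
    exact one_smul (A ⧸ I) b

/-- A module killed by `I` embeds into a power of `A ⧸ I`. -/
theorem Module.IsTorsionBySet.exists_linearMap_apply_ne_zero {I : Ideal A} (hI : I ≠ ⊥)
    (hN : Module.IsTorsionBySet A N I) {x : N} (hx : x ≠ 0) :
    ∃ φ : N →ₗ[A] A ⧸ I, φ x ≠ 0 := by
  have hIx : I ≤ Ideal.torsionOf A N x := fun a ha => hN (a := ⟨a, ha⟩) (x := x)
  obtain ⟨J, hJ⟩ := Ideal.dvd_iff_le.2 hIx
  -- `J` is the annihilator of the annihilator of `x` modulo `I`; it is larger than `I` as `x ≠ 0`.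
  have hJI : ¬ J ≤ I := by
    intro h
    have hJ0 : J ≠ 0 := by
      rintro rfl
      exact hI (by simpa using hJ)
    have h1 : Ideal.torsionOf A N x * J ∣ 1 * J := by
      rw [← hJ, one_mul, Ideal.dvd_iff_le]
      exact h
    rw [mul_dvd_mul_iff_right hJ0, Ideal.dvd_iff_le, Ideal.one_eq_top, top_le_iff,
      Ideal.torsionOf_eq_top_iff] at h1
    exact hx h1
  obtain ⟨b, hbJ, hbI⟩ := SetLike.not_le_iff_exists.1 hJI
  obtain ⟨φ, hφ⟩ := hN.exists_linearMap_apply_eq hI x (Ideal.Quotient.mk I b) (fun a ha => by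
    change Ideal.Quotient.mk I (a * b) = 0
    rw [Ideal.Quotient.eq_zero_iff_mem, hJ]
    exact Ideal.mul_mem_mul ha hbJ)
  exact ⟨φ, by rwa [hφ, Ne, Ideal.Quotient.eq_zero_iff_mem]⟩

end Quotient

/-! ### Closure properties of finitary reflective classes -/

namespace IsFinitaryReflective

section Closure

variable {A : Type u} [CommRing A] {S : ObjectProperty (ModuleCat.{u} A)}

theorem isClosedUnderLimitsOfShape (hS : IsFinitaryReflective S) (J : Type*) [Category J]
    [HasLimitsOfShape J (ModuleCat.{u} A)] : S.IsClosedUnderLimitsOfShape J := by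
  have := hS.isClosedUnderIsomorphisms
  have := hS.isRightAdjoint_ι
  let _ : Reflective S.ι := ⟨_, Adjunction.ofIsRightAdjoint _⟩
  have : HasLimitsOfShape J S.FullSubcategory := hasLimitsOfShape_of_reflective S.ι
  exact ObjectProperty.isClosedUnderLimitsOfShape_of_preservesLimitsOfShape_ι S J

variable {M N P : Type u} [AddCommGroup M] [Module A M] [AddCommGroup N] [Module A N]
  [AddCommGroup P] [Module A P]

theorem of_linearEquiv (hS : IsFinitaryReflective S) (e : M ≃ₗ[A] N) (h : S (.of A M)) :
    S (.of A N) :=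
  have := hS.isClosedUnderIsomorphisms
  S.prop_of_iso e.toModuleIso h

theorem pi (hS : IsFinitaryReflective S) {ι : Type u} (M : ι → Type u) [∀ i, AddCommGroup (M i)]
    [∀ i, Module A (M i)] (h : ∀ i, S (.of A (M i))) : S (.of A (∀ i, M i)) :=
  have := hS.isClosedUnderLimitsOfShape (Discrete ι)
  S.prop_of_isLimit (ModuleCat.productConeIsLimit fun i => ModuleCat.of A (M i)) fun i => h i.as

theorem prod (hS : IsFinitaryReflective S) (hM : S (.of A M)) (hN : S (.of A N)) :
    S (.of A (M × N)) :=
  have := hS.isClosedUnderLimitsOfShape (Discrete WalkingPair)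
  S.prop_of_isLimit (ModuleCat.binaryProductLimitCone (.of A M) (.of A N)).isLimit fun i => by
    rcases i with ⟨_ | _⟩
    · exact hM
    · exact hN

theorem of_exact (hS : IsFinitaryReflective S) {i : M →ₗ[A] N} {f : N →ₗ[A] P}
    (hi : Function.Injective i) (hf : Function.Exact i f) (hN : S (.of A N)) (hP : S (.of A P)) :
    S (.of A M) := by
  have := hS.isClosedUnderLimitsOfShape WalkingParallelPair
  have hker : S (.of A (LinearMap.ker f)) :=
    S.prop_of_isLimit (ModuleCat.kernelIsLimit (ModuleCat.ofHom f)) fun i => by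
      rcases i with _ | _
      · exact hN
      · exact hP
  exact hS.of_linearEquiv ((LinearEquiv.ofInjective i hi).trans
    (LinearEquiv.ofEq _ _ hf.linearMap_ker_eq.symm)).symm hker

theorem of_retract (hS : IsFinitaryReflective S) {i : M →ₗ[A] N} {p : N →ₗ[A] M}
    (h : ∀ x, p (i x) = x) (hN : S (.of A N)) : S (.of A M) :=
  hS.of_exact (i := i) (f := LinearMap.id - i ∘ₗ p) (Function.LeftInverse.injective h)
    (fun y => ⟨fun hy => ⟨p y, (sub_eq_zero.1 hy).symm⟩, by
      rintro ⟨x, rfl⟩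
      simp [h]⟩) hN hN

theorem of_projective (hS : IsFinitaryReflective S) [Module.Projective A M] : S (.of A M) := by
  obtain ⟨s, hs⟩ := Module.projective_def.1 (inferInstance : Module.Projective A M)
  exact hS.of_retract (N := M →₀ A) hs (hS.free M)

theorem torsionBySet (hS : IsFinitaryReflective S) (hM : S (.of A M)) (I : Ideal A) :
    S (.of A (Submodule.torsionBySet A M I)) :=
  hS.of_exact (i := (Submodule.torsionBySet A M I).subtype)
    (f := LinearMap.pi fun a : I => LinearMap.lsmul A M a) Subtype.val_injective
    (fun y => by simp [funext_iff]) hM (hS.pi _ fun _ => hM)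

/-- A module is the filtered union of its finitely generated submodules. -/
theorem of_fg (hS : IsFinitaryReflective S)
    (h : ∀ L : Submodule A M, L.FG → S (.of A L)) : S (.of A M) := by
  classical
  have := hS.isClosedUnderColimitsOfShape {L : Submodule A M // L.FG}
  exact hS.of_linearEquiv (Module.fgSystem.equiv A M)
    (S.prop_of_isColimit (ModuleCat.directLimitIsColimit _ (Module.fgSystem A M)) fun L => h _ L.2)

end Closure

section Dedekind

variable {A : Type u} [CommRing A] [IsDedekindDomain A] {S : ObjectProperty (ModuleCat.{u} A)}
variable {M N : Type u} [AddCommGroup M] [Module A M] [AddCommGroup N] [Module A N]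

/-- If `x ∈ M` has annihilator `I`, then `A ⧸ I` is a direct summand of the `I`-torsion of `M`. -/
theorem quotient_torsionOf (hS : IsFinitaryReflective S) (hM : S (.of A M)) (x : M)
    (hx : Ideal.torsionOf A M x ≠ ⊥) : S (.of A (A ⧸ Ideal.torsionOf A M x)) := by
  have hx' : x ∈ Submodule.torsionBySet A M (Ideal.torsionOf A M x) :=
    (Submodule.mem_torsionBySet_iff _ _).2 fun a => a.2
  obtain ⟨φ, hφ⟩ := (Submodule.torsionBySet_isTorsionBySet (R := A) (M := M)
    (Ideal.torsionOf A M x : Set A)).exists_linearMap_apply_eq hx ⟨x, hx'⟩ 1 fun a ha => by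
      change Ideal.Quotient.mk _ (a * 1) = 0
      rw [mul_one, Ideal.Quotient.eq_zero_iff_mem]
      exact congrArg Subtype.val ha
  refine hS.of_retract (p := φ) (i := Submodule.liftQ _ (LinearMap.toSpanSingleton A
      (Submodule.torsionBySet A M (Ideal.torsionOf A M x)) ⟨x, hx'⟩) fun a ha => Subtype.ext ha)
    (fun y => ?_) (hS.torsionBySet hM _)
  obtain ⟨a, rfl⟩ := Ideal.Quotient.mk_surjective y
  change φ (a • ⟨x, hx'⟩) = _
  rw [map_smul, hφ]
  exact congrArg (Ideal.Quotient.mk _) (mul_one a)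

/-- If `A ⧸ I` belongs to `S`, then so do all modules killed by `I`: each is the kernel of a linear
map between powers of `A ⧸ I`. -/
theorem of_isTorsionBySet (hS : IsFinitaryReflective S) {I : Ideal A} (hI : I ≠ ⊥)
    (h : S (.of A (A ⧸ I))) (hN : Module.IsTorsionBySet A N I) : S (.of A N) := by
  let i : N →ₗ[A] ((N →ₗ[A] A ⧸ I) → A ⧸ I) := LinearMap.pi fun φ => φ
  let Q := ((N →ₗ[A] A ⧸ I) → A ⧸ I) ⧸ LinearMap.range i
  let j : Q →ₗ[A] ((Q →ₗ[A] A ⧸ I) → A ⧸ I) := LinearMap.pi fun φ => φ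
  have hQ : Module.IsTorsionBySet A Q I := by
    intro y a
    obtain ⟨y, rfl⟩ := Submodule.mkQ_surjective _ y
    rw [← map_smul]
    refine (congrArg _ (?_ : (a : A) • y = 0)).trans (map_zero (LinearMap.range i).mkQ)
    ext φ
    obtain ⟨b, hb⟩ := Ideal.Quotient.mk_surjective (y φ)
    rw [Pi.smul_apply, ← hb]
    exact Ideal.Quotient.eq_zero_iff_mem.2 (I.mul_mem_right b a.2)
  have hi : Function.Injective i := by
    refine (injective_iff_map_eq_zero i).2 fun x hx => ?_
    by_contra hx0
    obtain ⟨φ, hφ⟩ := hN.exists_linearMap_apply_ne_zero hI hx0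
    exact hφ (congrFun hx φ)
  have hj : Function.Injective j := by
    refine (injective_iff_map_eq_zero j).2 fun x hx => ?_
    by_contra hx0
    obtain ⟨φ, hφ⟩ := hQ.exists_linearMap_apply_ne_zero hI hx0
    exact hφ (congrFun hx φ)
  refine hS.of_exact (f := j ∘ₗ (LinearMap.range i).mkQ) hi (fun y => ?_)
    (hS.pi _ fun _ => h) (hS.pi _ fun _ => h)
  rw [LinearMap.comp_apply, map_eq_zero_iff j hj, Submodule.mkQ_apply,
    Submodule.Quotient.mk_eq_zero]
  rfl

end Dedekind

end IsFinitaryReflective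

/-! ### Modules with bounded torsion -/

section Reflection

variable {A : Type u} [CommRing A] {S : ObjectProperty (ModuleCat.{u} A)}

/-- A class of modules closed under submodules and products is reflective: the reflection of `M` is
its largest quotient in the class. -/
theorem ModuleCat.isRightAdjoint_ι_of_injective_of_pi
    (hsub : ∀ {M N : ModuleCat.{u} A} (f : M →ₗ[A] N), Function.Injective f → S N → S M)
    (hpi : ∀ {ι : Type u} (M : ι → ModuleCat.{u} A), (∀ i, S (M i)) → S (.of A (∀ i, M i))) :
    S.ι.IsRightAdjoint := by
  let R (M : ModuleCat.{u} A) : Submodule A M := sInf {L | S (.of A (M ⧸ L))}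
  have hR (M : ModuleCat.{u} A) : S (.of A (M ⧸ R M)) := by
    have hle (L : {L : Submodule A M // S (.of A (M ⧸ L))}) : R M ≤ L := sInf_le L.2
    let j : M ⧸ R M →ₗ[A] (∀ L : {L : Submodule A M // S (.of A (M ⧸ L))}, M ⧸ L.1) :=
      LinearMap.pi fun L => Submodule.mapQ _ _ LinearMap.id (hle L)
    refine hsub (M := .of A (M ⧸ R M)) (N := .of A (∀ L : {L : Submodule A M //
      S (.of A (M ⧸ L))}, M ⧸ L.1)) j ?_ (hpi (fun L : {L : Submodule A M //
        S (.of A (M ⧸ L))} => .of A (M ⧸ L.1)) fun L => L.2)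
    refine (injective_iff_map_eq_zero j).2 fun x hx => ?_
    obtain ⟨x, rfl⟩ := Submodule.mkQ_surjective _ x
    refine (Submodule.Quotient.mk_eq_zero _).2 (Submodule.mem_sInf.2 fun L hL => ?_)
    exact (Submodule.Quotient.mk_eq_zero L).1 (congrFun hx ⟨L, hL⟩)
  have hker {M : ModuleCat.{u} A} (Y : S.FullSubcategory) (g : M ⟶ Y.obj) :
      R M ≤ LinearMap.ker g.hom :=
    sInf_le (hsub (M := .of A (M ⧸ LinearMap.ker g.hom)) (N := Y.obj)
      (Submodule.liftQ _ g.hom le_rfl)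
      (LinearMap.ker_eq_bot.1 (Submodule.ker_liftQ_eq_bot _ _ _ le_rfl)) Y.property)
  let e (M : ModuleCat.{u} A) (Y : S.FullSubcategory) :
      ((⟨.of A (M ⧸ R M), hR M⟩ : S.FullSubcategory) ⟶ Y) ≃ (M ⟶ S.ι.obj Y) :=
    { toFun f := ModuleCat.ofHom (R M).mkQ ≫ f.hom
      invFun g := ObjectProperty.homMk (ModuleCat.ofHom ((R M).liftQ g.hom (hker Y g)))
      left_inv f := by
        ext : 1
        exact ModuleCat.hom_ext (Submodule.linearMap_qext _ rfl)
      right_inv g := rfl }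
  exact (Adjunction.adjunctionOfEquivLeft e fun _ _ _ _ _ => rfl).isRightAdjoint

end Reflection

section FilteredColimit

variable {A : Type u} [CommRing A] {J : Type u} [SmallCategory J] [IsFiltered J]

/-- In a filtered colimit of modules, a finite set of scalars which kills the image of an element
already kills its image at some stage. -/
theorem ModuleCat.exists_forall_smul_map_eq_zero {F : J ⥤ ModuleCat.{u} A} {c : Cocone F}
    (hc : IsColimit c) {j : J} (y : F.obj j) (s : Finset A)
    (h : ∀ a ∈ s, a • (c.ι.app j).hom y = 0) :
    ∃ (k : J) (f : j ⟶ k), ∀ a ∈ s, a • (F.map f).hom y = 0 := by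
  classical
  induction s using Finset.induction_on with
  | empty => exact ⟨j, 𝟙 j, fun _ h => absurd h (Finset.notMem_empty _)⟩
  | insert a s _ ih =>
    obtain ⟨k, f, hf⟩ := ih fun b hb => h b (Finset.mem_insert_of_mem hb)
    have h0 : (c.ι.app k).hom (a • (F.map f).hom y) = (c.ι.app k).hom 0 := by
      rw [map_smul, map_zero, ← h a (Finset.mem_insert_self a s), ← c.w f]
      rfl
    obtain ⟨l, g, g', hg⟩ := Concrete.isColimit_exists_of_rep_eq F hc _ _ h0
    have hg0 : (F.map g).hom (a • (F.map f).hom y) = 0 := hg.trans (map_zero (F.map g').hom)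
    have hmap : (F.map (f ≫ g)).hom y = (F.map g).hom ((F.map f).hom y) := by
      rw [F.map_comp]
      rfl
    refine ⟨l, f ≫ g, fun b hb => ?_⟩
    rw [hmap, ← map_smul]
    rcases Finset.mem_insert.1 hb with rfl | hb
    · exact hg0
    · rw [hf b hb, map_zero]

/-- An element of a filtered colimit which is killed by a finitely generated ideal comes from an
element killed by this ideal. -/
theorem ModuleCat.exists_le_torsionOf_map {F : J ⥤ ModuleCat.{u} A} {c : Cocone F}
    (hc : IsColimit c) (x : c.pt) {I : Ideal A} (hI : I.FG) (h : I ≤ Ideal.torsionOf A c.pt x) :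
    ∃ (k : J) (y : F.obj k), (c.ι.app k).hom y = x ∧ I ≤ Ideal.torsionOf A (F.obj k) y := by
  obtain ⟨j, y, rfl⟩ := Concrete.isColimit_exists_rep F hc x
  obtain ⟨s, rfl⟩ := hI
  obtain ⟨k, f, hf⟩ := ModuleCat.exists_forall_smul_map_eq_zero hc y s
    fun a ha => h (Ideal.subset_span ha)
  refine ⟨k, (F.map f).hom y, ?_, Ideal.span_le.2 hf⟩
  rw [← c.w f]
  rfl

end FilteredColimit

section TorsionBounded

variable {A : Type u} [CommRing A]

/-- The class of modules in which the elements killed by a power of a maximal ideal `𝔪` are killed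
by `𝔪 ^ f 𝔪` (no condition if `f 𝔪 = ∞`). -/
def torsionBounded (f : MaximalSpectrum A → ℕ∞) : ObjectProperty (ModuleCat.{u} A) := fun M =>
  ∀ (𝔪 : MaximalSpectrum A) (n : ℕ), f 𝔪 ≤ n → ∀ x : M,
    𝔪.asIdeal ^ (n + 1) ≤ Ideal.torsionOf A M x → 𝔪.asIdeal ^ n ≤ Ideal.torsionOf A M x

theorem torsionBounded_mono {f g : MaximalSpectrum A → ℕ∞} (h : f ≤ g) :
    torsionBounded f ≤ torsionBounded g :=
  fun _ hM 𝔪 n hn => hM 𝔪 n ((h 𝔪).trans hn)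

theorem torsionBounded_of_injective {f : MaximalSpectrum A → ℕ∞} {M N : ModuleCat.{u} A}
    (i : M →ₗ[A] N) (hi : Function.Injective i) (hN : torsionBounded f N) :
    torsionBounded f M := by
  have h (x : M) : Ideal.torsionOf A M x = Ideal.torsionOf A N (i x) := by
    ext a
    rw [Ideal.mem_torsionOf_iff, Ideal.mem_torsionOf_iff, ← map_smul, map_eq_zero_iff i hi]
  intro 𝔪 n hn x hx
  rw [h] at hx ⊢
  exact hN 𝔪 n hn _ hx

theorem torsionBounded_pi {f : MaximalSpectrum A → ℕ∞} {ι : Type u} (M : ι → ModuleCat.{u} A)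
    (h : ∀ i, torsionBounded f (M i)) : torsionBounded f (.of A (∀ i, M i)) :=
  fun 𝔪 n hn x hx _ ha => funext fun i =>
    h i 𝔪 n hn (x i) (fun _ hb => congrFun (hx hb) i) ha

/-- Above the bound, it does not matter which power of `𝔪` kills an element. -/
theorem torsionBounded.pow_le_torsionOf {f : MaximalSpectrum A → ℕ∞} {M : ModuleCat.{u} A}
    (hM : torsionBounded f M) {𝔪 : MaximalSpectrum A} {n : ℕ} (hn : f 𝔪 ≤ n) {x : M} (e : ℕ)
    (hx : 𝔪.asIdeal ^ e ≤ Ideal.torsionOf A M x) : 𝔪.asIdeal ^ n ≤ Ideal.torsionOf A M x := by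
  induction e with
  | zero => exact (Ideal.pow_le_pow_right (Nat.zero_le n)).trans hx
  | succ e ih =>
    rcases le_or_gt (e + 1) n with h | h
    · exact (Ideal.pow_le_pow_right h).trans hx
    · exact ih (hM 𝔪 e (hn.trans (by exact_mod_cast Nat.le_of_lt_succ h)) x hx)

variable [IsDedekindDomain A]

theorem torsionBounded_of_isTorsionFree (hA : ¬ IsField A) (f : MaximalSpectrum A → ℕ∞)
    (M : ModuleCat.{u} A) [Module.IsTorsionFree A M] : torsionBounded f M := by
  intro 𝔪 n _ x hx
  obtain ⟨a, ha, ha0⟩ := Submodule.exists_mem_ne_zero_of_ne_bot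
    (pow_ne_zero (n + 1) (Ring.ne_bot_of_isMaximal_of_not_isField 𝔪.isMaximal hA))
  have : x = 0 := (smul_eq_zero_iff_right ha0).1 (hx ha)
  rw [this, Ideal.torsionOf_zero]
  exact le_top

theorem isFinitaryReflective_torsionBounded (hA : ¬ IsField A) (f : MaximalSpectrum A → ℕ∞) :
    IsFinitaryReflective (torsionBounded f) where
  isClosedUnderIsomorphisms := ⟨fun e h =>
    torsionBounded_of_injective e.toLinearEquiv.symm.toLinearMap
      e.toLinearEquiv.symm.injective h⟩
  isRightAdjoint_ι := ModuleCat.isRightAdjoint_ι_of_injective_of_pi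
    torsionBounded_of_injective torsionBounded_pi
  isClosedUnderColimitsOfShape J _ _ := ⟨by
    rintro M ⟨p⟩ 𝔪 n hn x hx
    obtain ⟨k, y, rfl, hy⟩ := ModuleCat.exists_le_torsionOf_map p.isColimit x
      (IsNoetherian.noetherian (𝔪.asIdeal ^ (n + 1))) hx
    intro a ha
    have h := p.prop_diag_obj k 𝔪 n hn y hy ha
    rw [Ideal.mem_torsionOf_iff] at h ⊢
    rw [← map_smul, h, map_zero]⟩
  free X :=
    have : Module.IsTorsionFree A ((ModuleCat.free A).obj X) :=
      inferInstanceAs (Module.IsTorsionFree A (X →₀ A))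
    torsionBounded_of_isTorsionFree hA f _

/-- The module `A ⧸ 𝔪 ^ k` has torsion bounded by `f` exactly if `k ≤ f 𝔪`. As `A` is not a field,
`𝔪` is nonzero and its powers are distinct. -/
theorem torsionBounded_quotient_pow_iff (hA : ¬ IsField A) (f : MaximalSpectrum A → ℕ∞)
    (𝔪 : MaximalSpectrum A) (k : ℕ) :
    torsionBounded f (.of A (A ⧸ 𝔪.asIdeal ^ k)) ↔ (k : ℕ∞) ≤ f 𝔪 := by
  have hne := Ring.ne_bot_of_isMaximal_of_not_isField 𝔪.isMaximal hA
  have htop := 𝔪.isMaximal.ne_top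
  have hone : Ideal.torsionOf A (A ⧸ 𝔪.asIdeal ^ k) 1 = 𝔪.asIdeal ^ k := by
    ext a
    rw [Ideal.mem_torsionOf_iff, ← Ideal.Quotient.eq_zero_iff_mem, ← mul_one a]
    simp [Algebra.smul_def]
  constructor
  · intro h
    by_contra! hk
    obtain ⟨n, hn⟩ := ENat.ne_top_iff_exists.1 hk.ne_top
    rw [← hn, Nat.cast_lt] at hk
    obtain ⟨j, rfl⟩ := Nat.exists_eq_add_of_le' (Nat.one_le_of_lt hk)
    have := h 𝔪 j (by rw [← hn]; exact_mod_cast Nat.le_of_lt_succ hk) 1 hone.ge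
    exact (Ideal.pow_right_strictAnti 𝔪.asIdeal hne htop (Nat.lt_succ_self j)).not_ge
      (this.trans hone.le)
  · intro hk 𝔫 n hn x hx
    have hkx : 𝔪.asIdeal ^ k ≤ Ideal.torsionOf A (A ⧸ 𝔪.asIdeal ^ k) x := by
      intro a ha
      obtain ⟨b, rfl⟩ := Ideal.Quotient.mk_surjective x
      exact Ideal.Quotient.eq_zero_iff_mem.2 (Ideal.mul_mem_right _ _ ha)
    by_cases h : 𝔫 = 𝔪
    · subst h
      exact (Ideal.pow_le_pow_right (by exact_mod_cast hk.trans hn)).trans hkx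
    · have hcop : IsCoprime (𝔫.asIdeal ^ (n + 1)) (𝔪.asIdeal ^ k) := by
        refine IsCoprime.pow (Ideal.isCoprime_iff_sup_eq.2 ?_)
        exact 𝔫.isMaximal.coprime_of_ne 𝔪.isMaximal fun h' => h (MaximalSpectrum.ext h')
      rw [Ideal.isCoprime_iff_sup_eq] at hcop
      exact le_top.trans (hcop.ge.trans (sup_le hx hkx))

end TorsionBounded

/-! ### Classification of the finitary reflective classes -/

section Exponent

variable {A : Type u} [CommRing A]

/-- The supremum of the `k` such that `A ⧸ 𝔪 ^ k` belongs to a given class of modules. -/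
noncomputable def cyclicExponent (S : ObjectProperty (ModuleCat.{u} A)) :
    MaximalSpectrum A → ℕ∞ := fun 𝔪 =>
  ⨆ k : {k : ℕ // S (.of A (A ⧸ 𝔪.asIdeal ^ k))}, ((k : ℕ) : ℕ∞)

theorem cyclicExponent_mono {S S' : ObjectProperty (ModuleCat.{u} A)} (h : S ≤ S') :
    cyclicExponent S ≤ cyclicExponent S' :=
  fun 𝔪 => iSup_le fun k => le_iSup (fun k : {k : ℕ // S' (.of A (A ⧸ 𝔪.asIdeal ^ k))} =>
    ((k : ℕ) : ℕ∞)) ⟨k, h _ k.2⟩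

variable [IsDedekindDomain A]

theorem cyclicExponent_torsionBounded (hA : ¬ IsField A) (f : MaximalSpectrum A → ℕ∞) :
    cyclicExponent (torsionBounded f) = f := by
  ext1 𝔪
  refine le_antisymm (iSup_le fun k => (torsionBounded_quotient_pow_iff hA f 𝔪 k).1 k.2) ?_
  refine ENat.forall_natCast_le_iff_le.1 fun k hk => ?_
  exact le_iSup (fun k : {k : ℕ // torsionBounded f (.of A (A ⧸ 𝔪.asIdeal ^ k))} =>
    ((k : ℕ) : ℕ∞)) ⟨k, (torsionBounded_quotient_pow_iff hA f 𝔪 k).2 hk⟩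

namespace IsFinitaryReflective

variable {S : ObjectProperty (ModuleCat.{u} A)}

/-- The supremum in the definition of the exponent is taken over an initial segment, since
`A ⧸ 𝔪 ^ k` is killed by `𝔪 ^ l` for `k ≤ l`. -/
theorem quotient_pow_of_le (hS : IsFinitaryReflective S) (hA : ¬ IsField A)
    {𝔪 : MaximalSpectrum A} {k : ℕ} (hk : (k : ℕ∞) ≤ cyclicExponent S 𝔪) :
    S (.of A (A ⧸ 𝔪.asIdeal ^ k)) := by
  have hne := Ring.ne_bot_of_isMaximal_of_not_isField 𝔪.isMaximal hA
  obtain ⟨l, hkl, hl⟩ : ∃ l, k ≤ l ∧ S (.of A (A ⧸ 𝔪.asIdeal ^ l)) := by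
    by_contra! h
    have hlt (l : {l : ℕ // S (.of A (A ⧸ 𝔪.asIdeal ^ l))}) : (l : ℕ) < k := by
      by_contra! hl
      exact h l hl l.2
    rcases k with _ | k
    · have : Subsingleton (A ⧸ 𝔪.asIdeal ^ 0) := by
        rw [pow_zero, Ideal.one_eq_top]
        infer_instance
      exact h 0 le_rfl hS.of_projective
    · have : cyclicExponent S 𝔪 ≤ k :=
        iSup_le fun l => by exact_mod_cast Nat.le_of_lt_succ (hlt l)
      have := hk.trans this
      norm_cast at this
      omega
  refine hS.of_isTorsionBySet (pow_ne_zero l hne) hl fun x a => ?_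
  obtain ⟨b, rfl⟩ := Ideal.Quotient.mk_surjective x
  exact Ideal.Quotient.eq_zero_iff_mem.2
    (Ideal.mul_mem_right _ _ (Ideal.pow_le_pow_right hkl a.2))

/-- The annihilator of an element killed by `𝔪 ^ (n + 1)` is a power `𝔪 ^ i`. If the element lies in
a module of `S`, then so does `A ⧸ 𝔪 ^ i`, which bounds `i`. -/
theorem le_torsionBounded (hS : IsFinitaryReflective S) (hA : ¬ IsField A) :
    S ≤ torsionBounded (cyclicExponent S) := by
  intro M hM 𝔪 n hn x hx
  have hne := Ring.ne_bot_of_isMaximal_of_not_isField 𝔪.isMaximal hA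
  have hp : Prime 𝔪.asIdeal := Ideal.prime_of_isPrime hne 𝔪.isMaximal.isPrime
  obtain ⟨i, hi, hix⟩ := (dvd_prime_pow hp (n + 1)).1 (Ideal.dvd_iff_le.2 hx)
  rw [associated_iff_eq] at hix
  rw [hix]
  refine Ideal.pow_le_pow_right ?_
  have h := hS.quotient_torsionOf (M := M) hM x (by rw [hix]; exact pow_ne_zero i hne)
  rw [hix] at h
  have : (i : ℕ∞) ≤ n := (le_iSup (fun k : {k : ℕ // S (.of A (A ⧸ 𝔪.asIdeal ^ k))} =>
    ((k : ℕ) : ℕ∞)) ⟨i, h⟩).trans hn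
  exact_mod_cast this

/-- The `𝔪`-primary part of a module with `𝔪`-torsion bounded by the exponent of `S` is killed by
some `𝔪 ^ k` such that `A ⧸ 𝔪 ^ k` belongs to `S`. -/
theorem torsionBySet_pow_of_torsionBounded (hS : IsFinitaryReflective S) (hA : ¬ IsField A)
    {M : ModuleCat.{u} A} (hM : torsionBounded (cyclicExponent S) M) (𝔪 : MaximalSpectrum A)
    (e : ℕ) : S (.of A (Submodule.torsionBySet A M (𝔪.asIdeal ^ e : Ideal A))) := by
  have hne := Ring.ne_bot_of_isMaximal_of_not_isField 𝔪.isMaximal hA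
  by_cases he : (e : ℕ∞) ≤ cyclicExponent S 𝔪
  · exact hS.of_isTorsionBySet (pow_ne_zero e hne) (hS.quotient_pow_of_le hA he)
      (Submodule.torsionBySet_isTorsionBySet _)
  · obtain ⟨n, hn⟩ := ENat.ne_top_iff_exists.1 (not_le.1 he).ne_top
    refine hS.of_isTorsionBySet (pow_ne_zero n hne) (hS.quotient_pow_of_le hA hn.le)
      fun x a => Subtype.ext ?_
    refine hM.pow_le_torsionOf hn.ge e (x := x.1) (fun b hb => ?_) a.2
    exact (Submodule.mem_torsionBySet_iff _ _).1 x.2 ⟨b, hb⟩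

/-- A finitely generated torsion module is the direct sum of its primary parts. -/
theorem of_torsionBounded_of_isTorsion (hS : IsFinitaryReflective S) (hA : ¬ IsField A)
    {M : ModuleCat.{u} A} (hM : torsionBounded (cyclicExponent S) M) [Module.Finite A M]
    (htors : Module.IsTorsion A M) : S M := by
  obtain ⟨P, _, hP, e, h⟩ := Submodule.exists_isInternal_prime_power_torsion htors
  refine hS.of_linearEquiv ((DirectSum.linearEquivFunOnFintype A P
    fun p => Submodule.torsionBySet A M (p.1 ^ e p : Ideal A)).symm.trans
      (LinearEquiv.ofBijective (DirectSum.coeLinearMap _) h)) (hS.pi _ fun p => ?_)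
  have hp := hP p.1 p.2
  exact hS.torsionBySet_pow_of_torsionBounded hA hM
    ⟨p.1, (Ideal.isPrime_of_prime hp).isMaximal hp.ne_zero⟩ (e p)

/-- A finitely generated module is a direct sum of a torsion module and a projective module. -/
theorem of_torsionBounded_of_finite (hS : IsFinitaryReflective S) (hA : ¬ IsField A)
    {M : ModuleCat.{u} A} (hM : torsionBounded (cyclicExponent S) M) [Module.Finite A M] :
    S M := by
  let T := Submodule.torsion A M
  have hT : S (.of A T) := hS.of_torsionBounded_of_isTorsion hA
    (torsionBounded_of_injective (M := .of A T) T.subtype Subtype.val_injective hM)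
    Submodule.torsion_isTorsion
  have : Module.FinitePresentation A (M ⧸ T) := Module.finitePresentation_of_finite A _
  have : Module.Projective A (M ⧸ T) := Module.Flat.projective_of_finitePresentation
  obtain ⟨s, hs⟩ := Module.projective_lifting_property T.mkQ LinearMap.id T.mkQ_surjective
  have hs' (q : M ⧸ T) : T.mkQ (s q) = q := LinearMap.congr_fun hs q
  -- A section `s` of `M → M ⧸ T` makes `M` a retract of `T × (M ⧸ T)`.
  let i : M →ₗ[A] T × (M ⧸ T) := LinearMap.prod
    (LinearMap.codRestrict T (LinearMap.id - s ∘ₗ T.mkQ) fun x => by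
      rw [← Submodule.Quotient.mk_eq_zero]
      change T.mkQ (x - s (T.mkQ x)) = 0
      rw [map_sub, hs', sub_self]) T.mkQ
  exact hS.of_retract (i := i) (p := LinearMap.coprod T.subtype s)
    (fun x => sub_add_cancel x (s (T.mkQ x))) (hS.prod hT hS.of_projective)

theorem torsionBounded_le (hS : IsFinitaryReflective S) (hA : ¬ IsField A) :
    torsionBounded (cyclicExponent S) ≤ S := fun _ hM =>
  hS.of_fg fun L hL =>
    have : Module.Finite A L := Module.Finite.iff_fg.2 hL
    hS.of_torsionBounded_of_finite hA
      (torsionBounded_of_injective (M := .of A L) L.subtype Subtype.val_injective hM)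

/-- Finitary reflective classes of modules are classified by their exponents. -/
theorem le_iff_cyclicExponent_le {S' : ObjectProperty (ModuleCat.{u} A)}
    (hS : IsFinitaryReflective S) (hS' : IsFinitaryReflective S') (hA : ¬ IsField A) :
    S ≤ S' ↔ cyclicExponent S ≤ cyclicExponent S' :=
  ⟨cyclicExponent_mono, fun h => (hS.le_torsionBounded hA).trans
    ((torsionBounded_mono h).trans (hS'.torsionBounded_le hA))⟩

end IsFinitaryReflective

end Exponent

/-! ### The equivalence of categories -/

namespace MonadPresentation

variable {A : Type u} [CommRing A] [IsDedekindDomain A]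

theorem nonempty_hom_iff_cyclicExponent_le (hA : ¬ IsField A)
    {P Q : MonadPresentation.{u, u, u + 1, u + 1} (freeModuleMonad A)}
    (hP : P.IsHomological ∧ P.IsFinitary) (hQ : Q.IsHomological ∧ Q.IsFinitary) :
    Nonempty (Hom P Q) ↔
      cyclicExponent P.toModule.essImage ≤ cyclicExponent Q.toModule.essImage := by
  have := hQ.1.full_toAlgebra
  have := hQ.1.faithful_toAlgebra
  rw [← (isFinitaryReflective_essImage_toModule hP.1 hP.2).le_iff_cyclicExponent_le
    (isFinitaryReflective_essImage_toModule hQ.1 hQ.2) hA, essImage_toModule_le_iff]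
  exact ⟨fun ⟨f⟩ => f.essImage_le, nonempty_hom_of_essImage_le⟩

/-- The functor sending a presentation to the exponents of the class of modules it defines. -/
noncomputable def exponentFunctor (hA : ¬ IsField A) :
    HoFinHPres.{u, u, u + 1, u + 1} (freeModuleMonad A) ⥤ MaxSpecFunction A where
  obj P := cyclicExponent P.obj.toModule.essImage
  map {P Q} f := homOfLE ((nonempty_hom_iff_cyclicExponent_le hA P.property Q.property).1
    ⟨Quotient.out f.hom⟩)

theorem isEquivalence_exponentFunctor (hA : ¬ IsField A) :
    (exponentFunctor hA).IsEquivalence where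
  faithful := ⟨fun {P Q} f g _ => by
    have := Q.property.1.full_toAlgebra
    have := Q.property.1.faithful_toAlgebra
    obtain ⟨⟨f⟩⟩ := f
    obtain ⟨⟨g⟩⟩ := g
    ext : 1
    exact Quotient.sound (f.homotopic_of_full_of_faithful g)⟩
  full := ⟨fun {P Q} f => by
    obtain ⟨g⟩ := (nonempty_hom_iff_cyclicExponent_le hA P.property Q.property).2 (leOfHom f)
    exact ⟨ObjectProperty.homMk (Quotient.mk _ g), Subsingleton.elim _ _⟩⟩
  essSurj := ⟨fun f => by
    have hS := isFinitaryReflective_torsionBounded hA f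
    refine ⟨⟨hS.presentation, hS.isHomological_presentation, hS.isFinitary_presentation⟩,
      ⟨eqToIso ?_⟩⟩
    change cyclicExponent hS.presentation.toModule.essImage = f
    rw [hS.essImage_toModule_presentation]
    exact cyclicExponent_torsionBounded hA f⟩

end MonadPresentation

theorem mainTheorem4 (A : Type u) [CommRing A] [IsDedekindDomain A] (hA : ¬ IsField A) :
    Nonempty (HoFinHPres.{u, u, u + 1, u + 1} (freeModuleMonad A) ≌ MaxSpecFunction A) := by
  have := MonadPresentation.isEquivalence_exponentFunctor hA
  exact ⟨(MonadPresentation.exponentFunctor hA).asEquivalence⟩
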